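/- Let $\mathbb F_q$ be a finite field and let $n,m\ge 0$ be integers. A rank-metric code is an $\mathbb F_q$-linear subspace $\mathcal C\subseteq \mathrm{Mat}_{n\times m}(\mathbb F_q)$. Put $\mathrm{maxrk}(\mathcal C)=\max\{\mathrm{rk}(M)\mid M\in\mathcal C\}$; the code $\mathcal C$ is an optimal anticode if $\dim(\mathcal C)=\max\{n,m\}\cdot\mathrm{maxrk}(\mathcal C)$. The support of $M\in\mathrm{Mat}_{n\times m}(\mathbb F_q)$ is its column space $\mathrm{supp}(M)=\mathrm{colsp}(M)\subseteq\mathbb F_q^n$ if $n\le m$, and its row space $\mathrm{supp}(M)=\mathrm{rowsp}(M)\subseteq\mathbb F_q^m$ if $n>m$. For a subspace $V\subseteq\mathbb F_q^{\min\{m,n\}}$ put $\mathrm{Mat}_{n\times m}(\mathbb F_q)(V)=\{M\in\mathrm{Mat}_{n\times m}(\mathbb F_q)\mid \mathrm{supp}(M)\subseteq V\}$. For a code $\mathcal C$ put $\mathcal C^{\mathsf T}=\{M^{\mathsf T}\mid M\in\mathcal C\}$. The standard optimal anticodes are: for $n\le m$ and $0\le k\le n$, the code of all matrices whose last $n-k$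 rows are zero; for $n\ge m$ and $0\le k\le m$, the code of all matrices whose last $m-k$ columns are zero (both kinds if $n=m$). The optimal anticodes of $\mathrm{Mat}_{n\times m}(\mathbb F_q)$ are exactly the following codes: - $\mathrm{Mat}_{n\times m}(\mathbb F_q)(V)$ for a subspace $V\subseteq\mathbb F_q^{\min\{m,n\}}$, if $m\neq n$; - $\mathrm{Mat}_{n\times n}(\mathbb F_q)(V)$ and $\mathrm{Mat}_{n\times n}(\mathbb F_q)(V)^{\mathsf T}$ for a subspace $V\subseteq\mathbb F_q^{n}$, if $m=n$. In particular, every optimal anticode $\mathcal C\subseteq\mathrm{Mat}_{n\times m}(\mathbb F_q)$ is equivalent to a standard optimal anticode $\mathcal S$: there is an $\mathbb F_q$-linear map $\varphi:\mathrm{Mat}_{n\times m}(\mathbb F_q)\to\mathrm{Mat}_{n\times m}(\mathbb F_q)$ that preserves the rank of every matrix, with $\varphi(\mathcal C)=\mathcal S$. Moreover $\varphi$ can be chosen of the form $\varphi(M)=AMB$ with $A\in\mathrm{GL}_n(\mathbb F_q)$ and $B\in\mathrm{GL}_m(\mathbb F_q)$. -/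

import Mathlib

/-- The column space of `M`: the subspace of `F ^ n` generated by the columns of `M`. -/
def colsp {F : Type*} [Field F] {n m : ℕ} (M : Matrix (Fin n) (Fin m) F) :
    Submodule F (Fin n → F) :=
  Submodule.span F (Set.range M.col)

/-- The row space of `M`: the subspace of `F ^ m` generated by the rows of `M`. -/
def rowsp {F : Type*} [Field F] {n m : ℕ} (M : Matrix (Fin n) (Fin m) F) :
    Submodule F (Fin m → F) :=
  Submodule.span F (Set.range M.row)

/-- The support of an `n × m` matrix, a subspace of `F ^ min {m, n}`: its column space if
`n ≤ m`, its row space if `n > m`. The maps `LinearEquiv.funCongrLeft` only rewrite the index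
set `Fin n` (resp. `Fin m`) as `Fin (min m n)`. -/
def supp {F : Type*} [Field F] {n m : ℕ} (M : Matrix (Fin n) (Fin m) F) :
    Submodule F (Fin (min m n) → F) :=
  if h : n ≤ m then
    (colsp M).map (LinearEquiv.funCongrLeft F F (finCongr (min_eq_right h))).toLinearMap
  else
    (rowsp M).map
      (LinearEquiv.funCongrLeft F F (finCongr (min_eq_left (le_of_not_ge h)))).toLinearMap

theorem colsp_zero {F : Type*} [Field F] {n m : ℕ} :
    colsp (0 : Matrix (Fin n) (Fin m) F) = ⊥ := by
  refine (Submodule.span_eq_bot).2 ?_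
  rintro _ ⟨j, rfl⟩
  rfl

theorem rowsp_zero {F : Type*} [Field F] {n m : ℕ} :
    rowsp (0 : Matrix (Fin n) (Fin m) F) = ⊥ := by
  refine (Submodule.span_eq_bot).2 ?_
  rintro _ ⟨j, rfl⟩
  rfl

theorem colsp_add_le {F : Type*} [Field F] {n m : ℕ} (M N : Matrix (Fin n) (Fin m) F) :
    colsp (M + N) ≤ colsp M ⊔ colsp N := by
  refine Submodule.span_le.2 ?_
  rintro _ ⟨j, rfl⟩
  exact Submodule.add_mem_sup (Submodule.subset_span ⟨j, rfl⟩) (Submodule.subset_span ⟨j, rfl⟩)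

theorem rowsp_add_le {F : Type*} [Field F] {n m : ℕ} (M N : Matrix (Fin n) (Fin m) F) :
    rowsp (M + N) ≤ rowsp M ⊔ rowsp N := by
  refine Submodule.span_le.2 ?_
  rintro _ ⟨j, rfl⟩
  exact Submodule.add_mem_sup (Submodule.subset_span ⟨j, rfl⟩) (Submodule.subset_span ⟨j, rfl⟩)

theorem colsp_smul_le {F : Type*} [Field F] {n m : ℕ} (c : F) (M : Matrix (Fin n) (Fin m) F) :
    colsp (c • M) ≤ colsp M := by
  refine Submodule.span_le.2 ?_
  rintro _ ⟨j, rfl⟩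
  exact Submodule.smul_mem _ c (Submodule.subset_span ⟨j, rfl⟩)

theorem rowsp_smul_le {F : Type*} [Field F] {n m : ℕ} (c : F) (M : Matrix (Fin n) (Fin m) F) :
    rowsp (c • M) ≤ rowsp M := by
  refine Submodule.span_le.2 ?_
  rintro _ ⟨j, rfl⟩
  exact Submodule.smul_mem _ c (Submodule.subset_span ⟨j, rfl⟩)

theorem supp_zero {F : Type*} [Field F] {n m : ℕ} :
    supp (0 : Matrix (Fin n) (Fin m) F) = ⊥ := by
  unfold supp
  split_ifs
  · rw [colsp_zero, Submodule.map_bot]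
  · rw [rowsp_zero, Submodule.map_bot]

theorem supp_add_le {F : Type*} [Field F] {n m : ℕ} (M N : Matrix (Fin n) (Fin m) F) :
    supp (M + N) ≤ supp M ⊔ supp N := by
  unfold supp
  split_ifs
  · rw [← Submodule.map_sup]
    exact Submodule.map_mono (colsp_add_le M N)
  · rw [← Submodule.map_sup]
    exact Submodule.map_mono (rowsp_add_le M N)

theorem supp_smul_le {F : Type*} [Field F] {n m : ℕ} (c : F) (M : Matrix (Fin n) (Fin m) F) :
    supp (c • M) ≤ supp M := by
  unfold supp
  split_ifs
  · exact Submodule.map_mono (colsp_smul_le c M)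
  · exact Submodule.map_mono (rowsp_smul_le c M)

/-- The subcode `C(V)` of a rank-metric code `C` supported on `V ⊆ F ^ min {m, n}`. -/
def supportedSubcode {F : Type*} [Field F] {n m : ℕ}
    (C : Submodule F (Matrix (Fin n) (Fin m) F)) (V : Submodule F (Fin (min m n) → F)) :
    Submodule F (Matrix (Fin n) (Fin m) F) where
  carrier := {M | M ∈ C ∧ supp M ≤ V}
  zero_mem' := ⟨C.zero_mem, by rw [supp_zero]; exact bot_le⟩
  add_mem' := fun {M N} hM hN =>
    ⟨C.add_mem hM.1 hN.1, (supp_add_le M N).trans (sup_le hM.2 hN.2)⟩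
  smul_mem' := fun c M hM => ⟨C.smul_mem c hM.1, (supp_smul_le c M).trans hM.2⟩

/-- `Mat_{n × m}(F)(V)`: all `n × m` matrices with support contained in `V`. -/
def matSupported {F : Type*} [Field F] (n m : ℕ) (V : Submodule F (Fin (min m n) → F)) :
    Submodule F (Matrix (Fin n) (Fin m) F) :=
  supportedSubcode ⊤ V

/-- The transposed code `{Mᵀ | M ∈ C}`. -/
def transposeCode {F : Type*} [Field F] {n m : ℕ}
    (C : Submodule F (Matrix (Fin n) (Fin m) F)) : Submodule F (Matrix (Fin m) (Fin n) F) :=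
  C.map (Matrix.transposeLinearEquiv (Fin n) (Fin m) F F).toLinearMap

/-- The maximum rank of a rank-metric code. The set of ranks is nonempty and bounded by `n`,
so this supremum is a maximum. -/
noncomputable def maxRank {F : Type*} [Field F] {n m : ℕ}
    (C : Submodule F (Matrix (Fin n) (Fin m) F)) : ℕ :=
  sSup {r | ∃ M ∈ C, M.rank = r}

/-- Optimal anticodes: linear codes with `dim C = max {n, m} * maxrk C`. -/
def IsOptimalAnticode {F : Type*} [Field F] {n m : ℕ}
    (C : Submodule F (Matrix (Fin n) (Fin m) F)) : Prop :=
  Module.finrank F C = max n m * maxRank C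

/-- Standard optimal anticodes: if `n ≤ m`, all matrices whose last `n - k` rows vanish; if
`n ≥ m`, all matrices whose last `m - k` columns vanish (both kinds if `n = m`). -/
def IsStandardOptimalAnticode {F : Type*} [Field F] {n m : ℕ}
    (C : Submodule F (Matrix (Fin n) (Fin m) F)) : Prop :=
  (n ≤ m ∧ ∃ k ≤ n, ∀ M, M ∈ C ↔ ∀ (i : Fin n) (j : Fin m), k ≤ (i : ℕ) → M i j = 0) ∨
  (m ≤ n ∧ ∃ k ≤ m, ∀ M, M ∈ C ↔ ∀ (i : Fin n) (j : Fin m), k ≤ (j : ℕ) → M i j = 0)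

/-- Linear isometries of the matrix space: linear maps that preserve the rank. -/
def IsRankIsometry {F : Type*} [Field F] {n m : ℕ}
    (φ : Matrix (Fin n) (Fin m) F →ₗ[F] Matrix (Fin n) (Fin m) F) : Prop :=
  ∀ M, (φ M).rank = M.rank

/-! Let n ≤ m and let r be the maximal rank of C. Call a cell (i, j) leading if some element of C
has its first nonzero entry, reading row by row, there. There are at least dim C = r * m leading
cells (`finrank_le_card_isLead`). On the other hand, leading cells in distinct rows and columns
yield one element of C whose rank is at least their number (`exists_card_le_rank_of_isLead`), so
every matching of rows into columns contains at most r leading cells. The m cyclic shifts of a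
matching partition the grid, so equality holds throughout and every matching contains exactly r of
them (`sum_matching_eq`). Exchanging two values of a matching shows that the leading cells form a
union of full rows or, only if n = m, possibly of full columns.

Suppose they are r full rows, indexed by I. Then C is parametrized by arbitrary rows in I, and each
remaining row is a linear function of these. Since no rank exceeds r, that function sends
independent tuples into their span, which makes it a fixed linear combination
(`exists_scalars_of_mem_span`). These relations among the rows say that all columns lie in one
subspace. Full columns reduce to this case by transposition. -/

open Module

/-! ### Linear functions of tuples with values in the span -/

/-- A matrix has rank at least the size of any linearly independent set of its rows. -/
theorem card_le_rank_of_linearIndepOn {F ι κ : Type*} [Field F] [Fintype κ]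
    {M : Matrix ι κ F} {R : Finset ι} (h : LinearIndepOn F M.row (R : Set ι)) :
    R.card ≤ M.rank := by
  have h' : LinearIndependent F (M.submatrix (fun i : R => (i : ι)) id).row := h
  have := h'.rank_matrix
  rw [Fintype.card_coe] at this
  rw [← this]
  exact Matrix.rank_submatrix_le _ _ _

/-- If `w` is independent of `v`, there are independent families of any size less than the
dimension which contain `v` and whose span avoids `w`. -/
theorem exists_linearIndependent_notMem_span {F E I : Type*} [Field F] [AddCommGroup E]
    [Module F E] [FiniteDimensional F E] [Fintype I] (hI : Fintype.card I < finrank F E)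
    (a : I) {v w : E} (hvw : LinearIndependent F ![v, w]) :
    ∃ φ : I → E, LinearIndependent F φ ∧ φ a = v ∧ w ∉ Submodule.span F (Set.range φ) := by
  classical
  have hne : v ≠ w := fun h => by
    have := hvw.injective.ne (show (0 : Fin 2) ≠ 1 by decide)
    exact this (by simpa using h)
  have hs : LinearIndepOn F id ({v, w} : Set E) := by
    have := hvw.linearIndepOn_id
    simpa [Matrix.range_cons, Set.pair_comm] using this
  let b := Basis.extend hs
  have hsub : ({v, w} : Set E) ⊆ hs.extend (Set.subset_univ _) := hs.subset_extend _
  let T := hs.extend (Set.subset_univ _)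
  have : Fintype T := FiniteDimensional.fintypeBasisIndex b
  have hb : ∀ t : T, b t = t := fun t => Basis.extend_apply_self hs t
  let v' : T := ⟨v, hsub (by simp)⟩
  let w' : T := ⟨w, hsub (by simp)⟩
  have hcard : finrank F E = Fintype.card T := finrank_eq_card_basis b
  have hle : Fintype.card I ≤ Fintype.card {t : T // t ≠ w'} := by
    rw [Fintype.card_subtype_compl, Fintype.card_subtype_eq]
    omega
  obtain ⟨g⟩ := Function.Embedding.nonempty_of_card_le hle
  let v'' : {t : T // t ≠ w'} := ⟨v', fun h => hne (congrArg Subtype.val h)⟩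
  -- Composing with a transposition puts `v` into slot `a`.
  let g' : I ↪ {t : T // t ≠ w'} := g.trans (Equiv.swap (g a) v'').toEmbedding
  have hg' : g' a = v'' := by simp [g']
  refine ⟨fun i => b (g' i : T), b.linearIndependent.comp (fun i => (g' i : T))
    (Subtype.val_injective.comp g'.injective), by simp [hg', hb, v'', v'], ?_⟩
  have := b.linearIndependent.notMem_span_image (s := {t | t ≠ w'}) (x := w') (by simp)
  rw [hb] at this
  refine fun h => this (Submodule.span_mono ?_ h)
  rintro _ ⟨i, rfl⟩
  exact ⟨_, (g' i).2, rfl⟩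

/-- A linear map sending every independent family into its span has scalar components. -/
theorem exists_scalars_of_mem_span {F E I : Type*} [Field F] [AddCommGroup E]
    [Module F E] [FiniteDimensional F E] [Fintype I] (hI : Fintype.card I < finrank F E)
    (f : (I → E) →ₗ[F] E)
    (hf : ∀ φ : I → E, LinearIndependent F φ → f φ ∈ Submodule.span F (Set.range φ)) :
    ∃ c : I → F, ∀ φ, f φ = ∑ j, c j • φ j := by
  classical
  have key : ∀ j, ∃ c : F, f ∘ₗ LinearMap.single F (fun _ => E) j = c • 1 := by
    intro j
    refine LinearMap.exists_eq_smul_id_of_forall_notLinearIndependent fun v hv => ?_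
    simp only [LinearMap.comp_apply, LinearMap.coe_single] at hv
    by_cases hsub : ∃ a, a ≠ j
    · obtain ⟨a, ha⟩ := hsub
      obtain ⟨φ, hφ, hφa, hw⟩ := exists_linearIndependent_notMem_span hI a hv
      have h1 := hf φ hφ
      -- Since `φ a = v` and `a ≠ j`, this adds one vector of the family to another. Independence
      -- survives and the span does not grow, so the difference of the two values of `f`, its value
      -- at `Pi.single j v`, lies in the span that was chosen to avoid it.
      have h2 : LinearIndependent F (φ + Pi.single j v) := by
        have h := linearIndependent_add_smul_iff (R := F) (v := φ) (c := fun i => if i = j then (1 : F) else 0)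
          (i := a) (by simp [ha])
        have he : (fun k => φ k + (if k = j then (1 : F) else 0) • φ a) = φ + Pi.single j v := by
          funext k
          by_cases hk : k = j
          · subst hk; simp [hφa]
          · simp [hk]
        exact he ▸ h.2 hφ
      have h3 := hf _ h2
      have hspan : Submodule.span F (Set.range (φ + Pi.single j v)) ≤
          Submodule.span F (Set.range φ) := by
        rw [Submodule.span_le]
        rintro _ ⟨k, rfl⟩
        refine add_mem (Submodule.subset_span ⟨k, rfl⟩) ?_
        by_cases hk : k = j
        · subst hk
          rw [Pi.single_eq_same, ← hφa]
          exact Submodule.subset_span (Set.mem_range_self a)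
        · simp [hk]
      refine hw ?_
      have := sub_mem (hspan h3) h1
      simpa using this
    -- Here `j` is the only index, so the tuple `Pi.single j v` is itself independent and spans a
    -- line.
    · push Not at hsub
      have hv0 : v ≠ 0 := by
        have := hv.ne_zero 0
        simpa using this
      have h1 := hf (Pi.single j v) (by
        have : Unique I := ⟨⟨j⟩, hsub⟩
        rw [linearIndependent_unique_iff]
        rw [hsub default]
        simpa using hv0)
      have h2 : Set.range (Pi.single j v : I → E) = {v} := by
        ext x
        constructor
        · rintro ⟨k, rfl⟩; rw [hsub k]; simp
        · rintro rfl; exact ⟨j, by simp⟩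
      rw [h2, Submodule.mem_span_singleton] at h1
      obtain ⟨c, hc⟩ := h1
      exact (LinearIndependent.pair_iff' hv0).1 hv c hc
  choose c hc using key
  refine ⟨c, fun φ => ?_⟩
  conv_lhs => rw [← Finset.univ_sum_single φ]
  rw [map_sum]
  refine Finset.sum_congr rfl fun j _ => ?_
  have := LinearMap.congr_fun (hc j) (φ j)
  simpa using this

/-! ### Codes determined by a subspace of columns -/

/-- The matrices whose columns all lie in `D`. -/
def colCode {F : Type*} [Field F] {n : ℕ} (m : ℕ) (D : Submodule F (Fin n → F)) :
    Submodule F (Matrix (Fin n) (Fin m) F) where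
  carrier := {M | ∀ j, M.col j ∈ D}
  zero_mem' := fun _ => D.zero_mem
  add_mem' := fun hM hN j => D.add_mem (hM j) (hN j)
  smul_mem' := fun c _ hM j => D.smul_mem c (hM j)

theorem mem_colCode {F : Type*} [Field F] {n m : ℕ} {D : Submodule F (Fin n → F)}
    {M : Matrix (Fin n) (Fin m) F} : M ∈ colCode m D ↔ ∀ j, M.col j ∈ D := Iff.rfl

theorem mem_transposeCode {F : Type*} [Field F] {n m : ℕ}
    {C : Submodule F (Matrix (Fin n) (Fin m) F)} {M : Matrix (Fin m) (Fin n) F} :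
    M ∈ transposeCode C ↔ M.transpose ∈ C := by
  constructor
  · rintro ⟨N, hN, rfl⟩
    simpa using hN
  · intro h
    exact ⟨_, h, by simp⟩

/-- If the rows indexed by `I` determine the elements of `C` and can be prescribed, while all
ranks are at most `#I`, then `C` consists of all matrices with columns in some subspace. -/
theorem exists_eq_colCode_of_rows {F : Type*} [Field F] {n m : ℕ}
    {C : Submodule F (Matrix (Fin n) (Fin m) F)} {I : Finset (Fin n)}
    (hinj : ∀ M ∈ C, (∀ i ∈ I, ∀ j, M i j = 0) → M = 0)
    (hdim : finrank F C = I.card * m) (hrank : ∀ M ∈ C, M.rank ≤ I.card) (hnm : n ≤ m) :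
    ∃ D : Submodule F (Fin n → F), C = colCode m D := by
  classical
  by_cases hI : I.card < m
  swap
  · refine ⟨⊤, ?_⟩
    have h1 : I.card ≤ n := by simpa using I.card_le_univ
    have h2 : I.card = n := by omega
    have : C = ⊤ := Submodule.eq_top_of_finrank_eq (by
      rw [hdim, h2]; simp [finrank_matrix])
    rw [this]
    ext M
    simp [mem_colCode]
  let ρ : C →ₗ[F] (I → Fin m → F) :=
    { toFun := fun M i => M.1 i
      map_add' := fun _ _ => rfl
      map_smul' := fun _ _ => rfl }
  have hρ : Function.Injective ρ := by
    rw [← LinearMap.ker_eq_bot, LinearMap.ker_eq_bot']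
    intro M hM
    exact Subtype.ext (hinj M.1 M.2 fun i hi j => congrFun (congrFun hM ⟨i, hi⟩) j)
  let e := LinearEquiv.ofInjectiveOfFinrankEq ρ hρ (by
    rw [hdim, finrank_pi_fintype]; simp)
  have he : ∀ φ (i : I), (e.symm φ).1 i = φ i := fun φ i =>
    congrFun (e.apply_symm_apply φ) i
  let f : Fin n → (I → Fin m → F) →ₗ[F] (Fin m → F) := fun i =>
    { toFun := fun φ => (e.symm φ).1 i
      map_add' := fun φ ψ => by rw [map_add]; rfl
      map_smul' := fun c φ => by rw [map_smul]; rfl }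
  have key : ∀ i, ∃ c : I → F, ∀ φ, f i φ = ∑ j, c j • φ j := by
    intro i
    -- If row `i` left the span of the independent rows in `I`, the rank would be at least `I.card +
    -- 1`.
    refine exists_scalars_of_mem_span (by simpa using hI) (f i) fun φ hφ => ?_
    by_contra hcon
    have hr : Set.range φ = (e.symm φ).1.row '' (I : Set (Fin n)) := by
      ext x
      constructor
      · rintro ⟨k, rfl⟩; exact ⟨k, k.2, he φ k⟩
      · rintro ⟨k, hk, rfl⟩; exact ⟨⟨k, hk⟩, (he φ ⟨k, hk⟩).symm⟩
    have hind : LinearIndepOn F (e.symm φ).1.row (I : Set (Fin n)) := by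
      have : φ = fun k : I => (e.symm φ).1.row k := funext fun k => (he φ k).symm
      have h : LinearIndependent F (fun k : I => (e.symm φ).1.row k) := by
        rw [← this]
        exact hφ
      exact h
    have hiI : i ∉ I := fun hi => hcon (Submodule.subset_span ⟨⟨i, hi⟩, (he φ ⟨i, hi⟩).symm⟩)
    have h1 : LinearIndepOn F (e.symm φ).1.row ((insert i I : Finset (Fin n)) : Set (Fin n)) := by
      rw [Finset.coe_insert]
      exact hind.insert (hr ▸ hcon)
    have h2 := card_le_rank_of_linearIndepOn h1
    rw [Finset.card_insert_of_notMem hiI] at h2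
    have := hrank _ (e.symm φ).2
    omega
  choose c hc using key
  -- The relations between rows hold entrywise, hence are equations satisfied by each column
  -- separately.
  let D : Submodule F (Fin n → F) :=
    ⨅ i, LinearMap.ker (LinearMap.proj i - ∑ j : I, c i j • LinearMap.proj (j : Fin n) :
      (Fin n → F) →ₗ[F] F)
  have hD : ∀ v, v ∈ D ↔ ∀ i, v i = ∑ j : I, c i j * v j := by
    intro v
    simp [D, sub_eq_zero]
  refine ⟨D, ?_⟩
  ext M
  rw [mem_colCode]
  simp only [hD, Matrix.col_apply]
  constructor
  · intro hM j i
    have := hc i (e ⟨M, hM⟩)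
    have h1 : f i (e ⟨M, hM⟩) = M i := by
      change (e.symm (e ⟨M, hM⟩)).1 i = M i
      rw [e.symm_apply_apply]
    rw [h1] at this
    rw [this]
    simp only [Finset.sum_apply]
    rfl
  · intro hM
    have : M = (e.symm (fun i : I => M i)).1 := by
      ext i j
      have := congrFun (hc i (fun i : I => M i)) j
      rw [hM j i]
      refine Eq.trans ?_ this.symm
      simp only [Finset.sum_apply]
      rfl
    rw [this]
    exact (e.symm _).2

/-! ### Matchings of a grid -/

/-- If every matching of an `n × m` grid with `n ≤ m` meets `s` in at most `r` cells, and `s` has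
at least `r * m` cells, then every matching meets `s` in exactly `r` cells. -/
theorem sum_matching_eq {n m r : ℕ} (hnm : n ≤ m) {s : Fin n → Fin m → ℕ}
    (hs : ∀ σ : Equiv.Perm (Fin m), ∑ i, s i (σ (Fin.castLE hnm i)) ≤ r)
    (hcard : r * m ≤ ∑ i, ∑ j, s i j) :
    (∀ σ : Equiv.Perm (Fin m), 0 < m → ∑ i, s i (σ (Fin.castLE hnm i)) = r) ∧
      ∑ i, ∑ j, s i j = r * m := by
  -- Without columns nothing bounds `r` from above, hence the condition `0 < m` in the first
  -- conclusion.
  rcases Nat.eq_zero_or_pos m with rfl | hm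
  · simp
  have : NeZero m := ⟨hm.ne'⟩
  -- The `m` cyclic shifts of a matching cover each cell exactly once.
  have hsum : ∀ σ : Equiv.Perm (Fin m), ∑ c : Fin m,
      ∑ i, s i (((Equiv.addRight c).trans σ) (Fin.castLE hnm i)) = ∑ i, ∑ j, s i j := by
    intro σ
    rw [Finset.sum_comm]
    refine Finset.sum_congr rfl fun i _ => ?_
    exact Fintype.sum_equiv ((Equiv.addLeft (Fin.castLE hnm i)).trans σ) _ _ fun c => rfl
  have hconst : ∑ _c : Fin m, r = r * m := by simp [mul_comm]
  have htot : ∑ i, ∑ j, s i j = r * m := by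
    refine le_antisymm ?_ hcard
    rw [← hsum 1, ← hconst]
    exact Finset.sum_le_sum fun c _ => hs _
  refine ⟨fun σ _ => ?_, htot⟩
  have h := (Finset.sum_eq_sum_iff_of_le (s := Finset.univ)
    (f := fun c : Fin m => ∑ i, s i (((Equiv.addRight c).trans σ) (Fin.castLE hnm i)))
    (g := fun _ => r) (fun c _ => hs _)).1 (by rw [hsum σ, htot, hconst]) 0 (Finset.mem_univ _)
  simpa using h

theorem exists_perm_apply_eq {α : Type*} [DecidableEq α] {a b c d : α} (hab : a ≠ b)
    (hcd : c ≠ d) : ∃ σ : Equiv.Perm α, σ a = c ∧ σ b = d := by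
  refine ⟨(Equiv.swap a c).trans (Equiv.swap (Equiv.swap a c b) d), ?_, by simp⟩
  simp only [Equiv.trans_apply, Equiv.swap_apply_left]
  refine Equiv.swap_apply_of_ne_of_ne (fun h => hab ?_) hcd
  have := congrArg (Equiv.swap a c) h
  simpa using this

/-- A subset of the `n × m` grid with `n < m` which meets all matchings in the same number of
cells is a union of rows. -/
theorem rows_constant_of_lt {n m r : ℕ} (hnm : n < m) {s : Fin n → Fin m → ℕ}
    (hs : ∀ σ : Equiv.Perm (Fin m), ∑ i, s i (σ (Fin.castLE hnm.le i)) = r)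
    (i : Fin n) (j j' : Fin m) : s i j = s i j' := by
  by_cases hj : j = j'
  · rw [hj]
  -- The index `n` belongs to no row, so `j'` is a column unused by the matching; swapping `j` and
  -- `j'` then moves only the cell in row `i`.
  obtain ⟨σ, h1, h2⟩ := exists_perm_apply_eq (a := Fin.castLE hnm.le i) (b := ⟨n, hnm⟩)
    (by simp [Fin.ext_iff, i.2.ne]) hj
  have h := (hs σ).trans (hs (σ.trans (Equiv.swap j j'))).symm
  rw [← Finset.add_sum_erase _ _ (Finset.mem_univ i),
    ← Finset.add_sum_erase _ _ (Finset.mem_univ i)] at h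
  have h3 : ∀ k ∈ Finset.univ.erase i, s k (σ (Fin.castLE hnm.le k)) =
      s k ((σ.trans (Equiv.swap j j')) (Fin.castLE hnm.le k)) := by
    intro k hk
    rw [Equiv.trans_apply, Equiv.swap_apply_of_ne_of_ne]
    · rw [← h1]
      refine σ.injective.ne fun h => Finset.ne_of_mem_erase hk ?_
      simpa [Fin.ext_iff] using h
    · rw [← h2]
      refine σ.injective.ne fun h => ?_
      exact k.2.ne (Fin.ext_iff.1 h)
  rw [Finset.sum_congr rfl h3] at h
  simpa [h1] using h

/-- If all matchings of the square grid meet `s` in the same number of cells, then `s`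
is additively separable. -/
theorem add_eq_add_of_sum_matching {n r : ℕ} {s : Fin n → Fin n → ℕ}
    (hs : ∀ σ : Equiv.Perm (Fin n), ∑ i, s i (σ i) = r) (i i' j j' : Fin n) :
    s i j + s i' j' = s i j' + s i' j := by
  by_cases hj : j = j'
  · rw [hj]
  by_cases hi : i = i'
  · rw [hi, add_comm]
  obtain ⟨σ, h1, h2⟩ := exists_perm_apply_eq hi hj
  have h := (hs σ).trans (hs (σ.trans (Equiv.swap j j'))).symm
  have hi' : i' ∈ Finset.univ.erase i := Finset.mem_erase.2 ⟨Ne.symm hi, Finset.mem_univ _⟩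
  rw [← Finset.add_sum_erase _ _ (Finset.mem_univ i),
    ← Finset.add_sum_erase _ _ (Finset.mem_univ i), ← Finset.add_sum_erase _ _ hi',
    ← Finset.add_sum_erase _ _ hi'] at h
  have h3 : ∀ k ∈ (Finset.univ.erase i).erase i', s k (σ k) =
      s k ((σ.trans (Equiv.swap j j')) k) := by
    intro k hk
    rw [Equiv.trans_apply, Equiv.swap_apply_of_ne_of_ne]
    · rw [← h1]
      exact σ.injective.ne (Finset.ne_of_mem_erase (Finset.mem_of_mem_erase hk))
    · rw [← h2]
      exact σ.injective.ne (Finset.ne_of_mem_erase hk)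
  rw [Finset.sum_congr rfl h3] at h
  simp only [Equiv.trans_apply, h1, h2, Equiv.swap_apply_left, Equiv.swap_apply_right] at h
  omega

/-- An additively separable `0`-`1` matrix has constant rows or constant columns. -/
theorem rows_or_cols_constant {α β : Type*} {s : α → β → ℕ} (h01 : ∀ i j, s i j ≤ 1)
    (hs : ∀ i i' j j', s i j + s i' j' = s i j' + s i' j) :
    (∀ i j j', s i j = s i j') ∨ (∀ i i' j, s i j = s i' j) := by
  by_contra! h
  obtain ⟨⟨i, j, j', h1⟩, ⟨k, k', l, h2⟩⟩ := h
  -- Passing from `j` to `j'` changes all rows by the same ±1, and from `k` to `k'` all columns by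
  -- the same ±1. Among the four cells of these rows and columns two would differ by 2.
  have e1 := hs i k j l
  have e2 := hs i k j' l
  have e3 := hs i k' j l
  have e4 := hs i k' j' l
  have := h01 i j
  have := h01 i j'
  have := h01 i l
  have := h01 k l
  have := h01 k' l
  have := h01 k j
  have := h01 k j'
  have := h01 k' j
  have := h01 k' j'
  omega

/-! ### Leading positions, rank and dimension -/

/-- The first nonzero entry of `M`, reading row by row, is at position `(i, j)`. -/
def IsLead {F : Type*} [Field F] {n m : ℕ} (M : Matrix (Fin n) (Fin m) F) (i : Fin n)
    (j : Fin m) : Prop :=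
  (∀ i' < i, M i' = 0) ∧ (∀ j' < j, M i j' = 0) ∧ M i j ≠ 0

theorem exists_isLead {F : Type*} [Field F] {n m : ℕ} {M : Matrix (Fin n) (Fin m) F}
    (hM : M ≠ 0) : ∃ i j, IsLead M i j := by
  have h1 : ∃ i, M i ≠ 0 := by
    by_contra! h
    exact hM (funext h)
  obtain ⟨i, hi, himin⟩ := WellFounded.has_min wellFounded_lt {i | M i ≠ 0} h1
  have h2 : ∃ j, M i j ≠ 0 := by
    by_contra! h
    exact hi (funext h)
  obtain ⟨j, hj, hjmin⟩ := WellFounded.has_min wellFounded_lt {j | M i j ≠ 0} h2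
  refine ⟨i, j, fun i' h => ?_, fun j' h => ?_, hj⟩
  · by_contra h'
    exact himin i' h' h
  · by_contra h'
    exact hjmin j' h' h

/-- Vectors whose first nonzero entries are at distinct positions are independent. -/
theorem linearIndependent_of_injective_lead {F ι κ : Type*} [Field F] [Fintype ι]
    [LinearOrder κ] [WellFoundedLT κ] {a : ι → κ → F} {c : ι → κ} (hc : Function.Injective c)
    (h0 : ∀ i, ∀ j < c i, a i j = 0) (h1 : ∀ i, a i (c i) ≠ 0) : LinearIndependent F a := by
  rw [Fintype.linearIndependent_iff]
  intro g hg
  have : ∀ k : κ, ∀ i, c i = k → g i = 0 := by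
    intro k
    induction k using WellFoundedLT.induction with
    | ind k ih =>
      rintro i rfl
      have h := congrFun hg (c i)
      rw [Finset.sum_apply, Finset.sum_eq_single i] at h
      · simpa [h1 i] using h
      · intro i' _ hne
        rcases lt_trichotomy (c i') (c i) with hlt | heq | hgt
        · simp [ih _ hlt i' rfl]
        · exact absurd (hc heq) hne
        · simp [h0 i' _ hgt]
      · simp
  exact fun i => this _ i rfl

/-- Replacing one vector `f s` of an independent family by `v` or by `v + f s` keeps it
independent in at least one of the two cases. -/
theorem LinearIndepOn.or_of_eq_add {F ι V : Type*} [Field F] [AddCommGroup V] [Module F V]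
    {f g g' : ι → V} {R : Set ι} {s : ι} (hs : s ∈ R) (hf : LinearIndepOn F f R)
    (hg : ∀ i ∈ R, i ≠ s → g i = f i) (hg' : ∀ i ∈ R, i ≠ s → g' i = f i)
    (hs' : g' s = g s + f s) : LinearIndepOn F g R ∨ LinearIndepOn F g' R := by
  have hR : R = insert s (R \ {s}) := by simp [Set.insert_eq_of_mem hs]
  have hsR : s ∉ R \ {s} := by simp
  rw [hR, linearIndepOn_insert hsR] at hf
  have hiff : ∀ h : ι → V, (∀ i ∈ R, i ≠ s → h i = f i) →
      (LinearIndepOn F h R ↔ h s ∉ Submodule.span F (f '' (R \ {s}))) := by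
    intro h hh
    have hcongr : Set.EqOn f h (R \ {s}) := fun i hi => (hh i hi.1 hi.2).symm
    rw [hR, linearIndepOn_insert hsR, ← hR, ← hcongr.image_eq]
    exact and_iff_right (hf.1.congr hcongr)
  rw [hiff g hg, hiff g' hg', hs', ← not_and_or]
  exact fun h => hf.2 (by simpa using sub_mem h.2 h.1)

/-- Leading positions in distinct rows and columns force an element of large rank. -/
theorem exists_card_le_rank_of_isLead {F : Type*} [Field F] {n m : ℕ}
    {C : Submodule F (Matrix (Fin n) (Fin m) F)} {R : Finset (Fin n)} {c : Fin n → Fin m}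
    (hc : Set.InjOn c R) {A : Fin n → Matrix (Fin n) (Fin m) F} (hAC : ∀ i ∈ R, A i ∈ C)
    (hA : ∀ i ∈ R, IsLead (A i) i (c i)) : ∃ N ∈ C, R.card ≤ N.rank := by
  -- Sweep downwards, keeping independent the family of rows of one element `N` above `t` and the
  -- leading rows of the various `A i` from `t` on. At `t = 0` the leads lie in distinct columns; at
  -- `t = n` only rows of `N` remain.
  have key : ∀ t ≤ n, ∃ N ∈ C,
      LinearIndepOn F (fun i : Fin n => if (i : ℕ) < t then N i else A i i) (R : Set (Fin n)) := by
    intro t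
    induction t with
    | zero =>
      intro _
      refine ⟨0, C.zero_mem, ?_⟩
      simp only [not_lt_zero, if_false]
      exact linearIndependent_of_injective_lead (c := fun i : (R : Set (Fin n)) => c i)
        (Set.injOn_iff_injective.1 hc) (fun i => (hA i i.2).2.1) (fun i => (hA i i.2).2.2)
    | succ t ih =>
      intro ht
      obtain ⟨N, hNC, hN⟩ := ih (by omega)
      let s : Fin n := ⟨t, ht⟩
      by_cases hs : s ∈ R
      swap
      · refine ⟨N, hNC, hN.congr fun i hi => ?_⟩
        have : (i : ℕ) ≠ t := fun h => hs ((Fin.ext h : i = s) ▸ hi)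
        have h' : (i : ℕ) < t ↔ (i : ℕ) < t + 1 := by omega
        simp only [h']
      have hrow : ∀ N' : Matrix (Fin n) (Fin m) F, (∀ i < s, N' i = N i) →
          ∀ i ∈ (R : Set (Fin n)), i ≠ s → (if (i : ℕ) < t + 1 then N' i else A i i) =
            if (i : ℕ) < t then N i else A i i := by
        intro N' hN' i _ hi
        have h1 : (i : ℕ) ≠ t := fun h => hi (Fin.ext h)
        have h' : (i : ℕ) < t + 1 ↔ (i : ℕ) < t := by omega
        simp only [h']
        split_ifs with h
        · exact hN' i h
        · rfl
      -- `A s` vanishes above its leading row, so adding it keeps the rows already treated.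
      have hzero : ∀ i < s, (N + A s) i = N i := fun i hi => by
        change N i + A s i = N i
        rw [(hA s hs).1 i hi, add_zero]
      rcases hN.or_of_eq_add (g := fun i : Fin n => if (i : ℕ) < t + 1 then N i else A i i)
        (g' := fun i : Fin n => if (i : ℕ) < t + 1 then (N + A s) i else A i i) hs
        (hrow N fun _ _ => rfl) (hrow _ hzero) (by simp [s]; rfl) with h | h
      · exact ⟨N, hNC, h⟩
      · exact ⟨N + A s, C.add_mem hNC (hAC s hs), h⟩
  obtain ⟨N, hNC, hN⟩ := key n le_rfl
  refine ⟨N, hNC, card_le_rank_of_linearIndepOn ?_⟩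
  simp only [Fin.is_lt, if_true] at hN
  exact hN

/-! ### Transposition and the shape of optimal anticodes -/

theorem finrank_transposeCode {F : Type*} [Field F] {n m : ℕ}
    (C : Submodule F (Matrix (Fin n) (Fin m) F)) :
    finrank F (transposeCode C) = finrank F C :=
  LinearEquiv.finrank_map_eq (Matrix.transposeLinearEquiv (Fin n) (Fin m) F F) C

theorem maxRank_transposeCode {F : Type*} [Field F] {n m : ℕ}
    (C : Submodule F (Matrix (Fin n) (Fin m) F)) : maxRank (transposeCode C) = maxRank C := by
  unfold maxRank
  congr 1
  ext r
  constructor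
  · rintro ⟨M, hM, rfl⟩
    exact ⟨_, mem_transposeCode.1 hM, Matrix.rank_transpose M⟩
  · rintro ⟨M, hM, rfl⟩
    exact ⟨M.transpose, mem_transposeCode.2 (by simpa using hM), Matrix.rank_transpose M⟩

theorem isOptimalAnticode_transposeCode {F : Type*} [Field F] {n m : ℕ}
    {C : Submodule F (Matrix (Fin n) (Fin m) F)} :
    IsOptimalAnticode (transposeCode C) ↔ IsOptimalAnticode C := by
  unfold IsOptimalAnticode
  rw [finrank_transposeCode, maxRank_transposeCode, max_comm]

theorem transposeCode_transposeCode {F : Type*} [Field F] {n m : ℕ}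
    (C : Submodule F (Matrix (Fin n) (Fin m) F)) : transposeCode (transposeCode C) = C := by
  ext M
  simp [mem_transposeCode]

theorem rank_le_maxRank {F : Type*} [Field F] {n m : ℕ}
    {C : Submodule F (Matrix (Fin n) (Fin m) F)} {M : Matrix (Fin n) (Fin m) F} (hM : M ∈ C) :
    M.rank ≤ maxRank C :=
  le_csSup ⟨n, by rintro _ ⟨N, _, rfl⟩; exact N.rank_le_height⟩ ⟨M, hM, rfl⟩

/-- The dimension of a code is at most the number of leading positions of its elements. -/
theorem finrank_le_card_isLead {F : Type*} [Field F] {n m : ℕ}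
    {C : Submodule F (Matrix (Fin n) (Fin m) F)} {S : Finset (Fin n × Fin m)}
    (hS : ∀ M ∈ C, ∀ i j, IsLead M i j → (i, j) ∈ S) : finrank F C ≤ S.card := by
  let ρ : C →ₗ[F] (S → F) :=
    { toFun := fun M p => M.1 p.1.1 p.1.2
      map_add' := fun _ _ => rfl
      map_smul' := fun _ _ => rfl }
  -- A nonzero element does not vanish at its own leading position, which belongs to `S`.
  have hρ : Function.Injective ρ := by
    rw [← LinearMap.ker_eq_bot, LinearMap.ker_eq_bot']
    intro M hM
    by_contra hne
    obtain ⟨i, j, h⟩ := exists_isLead fun h => hne (Subtype.ext h)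
    exact h.2.2 (congrFun hM ⟨(i, j), hS _ M.2 _ _ h⟩)
  simpa using LinearMap.finrank_le_finrank_of_injective hρ

theorem exists_colCode_of_isOptimalAnticode {F : Type*} [Field F] {n m : ℕ} (hnm : n ≤ m)
    {C : Submodule F (Matrix (Fin n) (Fin m) F)} (hC : IsOptimalAnticode C) :
    (∃ D : Submodule F (Fin n → F), C = colCode m D) ∨
      (n = m ∧ ∃ D : Submodule F (Fin m → F), C = transposeCode (colCode n D)) := by
  classical
  rcases Nat.eq_zero_or_pos m with rfl | hm
  · refine Or.inl ⟨⊤, ?_⟩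
    ext M
    rw [Subsingleton.elim M 0]
    exact iff_of_true C.zero_mem (zero_mem _)
  let P : Fin n → Fin m → Prop := fun i j => ∃ M ∈ C, IsLead M i j
  let s : Fin n → Fin m → ℕ := fun i j => if P i j then 1 else 0
  have hdim : finrank F C = maxRank C * m := by
    rw [hC, max_eq_right hnm, mul_comm]
  have hs : ∀ σ : Equiv.Perm (Fin m), ∑ i, s i (σ (Fin.castLE hnm i)) ≤ maxRank C := by
    intro σ
    let R : Finset (Fin n) := {i | P i (σ (Fin.castLE hnm i))}
    have hR : ∀ i : Fin n, ∃ A, i ∈ R → A ∈ C ∧ IsLead A i (σ (Fin.castLE hnm i)) := by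
      intro i
      by_cases hi : P i (σ (Fin.castLE hnm i))
      · exact ⟨hi.choose, fun _ => hi.choose_spec⟩
      · exact ⟨0, fun h => absurd (Finset.mem_filter.1 h).2 hi⟩
    choose A hA using hR
    obtain ⟨N, hN, hNr⟩ := exists_card_le_rank_of_isLead (C := C) (R := R)
      (c := fun i => σ (Fin.castLE hnm i))
      (σ.injective.comp (Fin.castLE_injective hnm)).injOn
      (fun i hi => (hA i hi).1) (fun i hi => (hA i hi).2)
    refine le_trans (le_of_eq ?_) (hNr.trans (rank_le_maxRank hN))
    exact (Finset.card_filter _ _).symm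
  have hcard : maxRank C * m ≤ ∑ i, ∑ j, s i j := by
    rw [← hdim]
    refine (finrank_le_card_isLead (S := {p | P p.1 p.2}) fun M hM i j h => ?_).trans
      (le_of_eq ?_)
    · simpa using ⟨M, hM, h⟩
    · rw [Finset.card_filter, ← Finset.univ_product_univ, Finset.sum_product]
  obtain ⟨hmatch, htot⟩ := sum_matching_eq hnm hs hcard
  -- If the leading cells fill the rows in `I`, an element vanishing on these rows has no place for
  -- a lead. Column `0` serves to read off `I`.
  have hrows : (∀ i j j', s i j = s i j') → ∃ D : Submodule F (Fin n → F), C = colCode m D := by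
    intro h
    let I : Finset (Fin n) := {i | P i ⟨0, hm⟩}
    have hI : I.card = maxRank C := by
      refine Nat.eq_of_mul_eq_mul_right hm ?_
      rw [← htot, Finset.card_filter, Finset.sum_mul]
      refine Finset.sum_congr rfl fun i _ => ?_
      rw [Finset.sum_congr rfl fun j _ => h i j ⟨0, hm⟩]
      simp [s, mul_comm]
    refine exists_eq_colCode_of_rows (I := I) (fun M hM h0 => ?_) (by rw [hdim, hI])
      (fun M hM => hI ▸ rank_le_maxRank hM) hnm
    by_contra hne
    obtain ⟨i, j, hl⟩ := exists_isLead hne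
    refine hl.2.2 (h0 i ?_ j)
    have h1 : s i j = 1 := if_pos ⟨M, hM, hl⟩
    rw [h i j ⟨0, hm⟩] at h1
    simpa [I, s] using h1
  rcases hnm.lt_or_eq with hlt | rfl
  · exact Or.inl (hrows (rows_constant_of_lt hlt fun σ => hmatch σ hm))
  rcases rows_or_cols_constant (s := s) (fun i j => by simp only [s]; split_ifs <;> simp)
    (add_eq_add_of_sum_matching fun σ => hmatch σ hm) with h | h
  · exact Or.inl (hrows h)
  -- The leading cells now fill the columns in `J`. The leads are still those of `C` itself: each
  -- nonzero element has its lead in a column of `J`, so the rows in `J` determine its transpose.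
  refine Or.inr ⟨rfl, ?_⟩
  let J : Finset (Fin n) := {j | P ⟨0, hm⟩ j}
  have hJ : J.card = maxRank C := by
    refine Nat.eq_of_mul_eq_mul_right hm ?_
    rw [← htot, Finset.sum_comm, Finset.card_filter, Finset.sum_mul]
    refine Finset.sum_congr rfl fun j _ => ?_
    rw [Finset.sum_congr rfl fun i _ => h i ⟨0, hm⟩ j]
    simp [s, mul_comm]
  obtain ⟨D, hD⟩ := exists_eq_colCode_of_rows (C := transposeCode C) (I := J)
    (fun M hM h0 => by
      by_contra hne
      obtain ⟨i, j, hl⟩ := exists_isLead (M := M.transpose) (by simpa using hne)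
      refine hl.2.2 (h0 j ?_ i)
      have h1 : s i j = 1 := if_pos ⟨_, mem_transposeCode.1 hM, hl⟩
      rw [h i ⟨0, hm⟩ j] at h1
      simpa [J, s] using h1)
    (by rw [finrank_transposeCode, hdim, hJ])
    (fun M hM => by rw [hJ, ← maxRank_transposeCode]; exact rank_le_maxRank hM) le_rfl
  exact ⟨D, by rw [← hD, transposeCode_transposeCode]⟩

/-! ### Column codes are optimal anticodes -/

theorem finrank_colCode {F : Type*} [Field F] {n m : ℕ} (D : Submodule F (Fin n → F)) :
    finrank F (colCode m D) = m * finrank F D := by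
  let e : colCode m D ≃ₗ[F] (Fin m → D) :=
    { toFun := fun M j => ⟨M.1.col j, M.2 j⟩
      map_add' := fun _ _ => rfl
      map_smul' := fun _ _ => rfl
      invFun := fun φ => ⟨Matrix.of fun i j => (φ j).1 i, fun j => (φ j).2⟩
      left_inv := fun _ => rfl
      right_inv := fun _ => rfl }
  rw [e.finrank_eq, finrank_pi_fintype]
  simp

/-- As `n ≤ m`, there are enough columns to hold a basis of `D`, padded with zero columns. -/
theorem maxRank_colCode {F : Type*} [Field F] {n m : ℕ} (hnm : n ≤ m)
    (D : Submodule F (Fin n → F)) : maxRank (colCode m D) = finrank F D := by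
  refine le_antisymm (csSup_le ⟨_, 0, zero_mem _, rfl⟩ ?_) ?_
  · rintro _ ⟨M, hM, rfl⟩
    rw [Matrix.rank_eq_finrank_span_cols]
    refine Submodule.finrank_mono (Submodule.span_le.2 ?_)
    rintro _ ⟨j, rfl⟩
    exact hM j
  · let b := finBasis F D
    have hd : finrank F D ≤ m := (Submodule.finrank_le D).trans (by simpa using hnm)
    let M : Matrix (Fin n) (Fin m) F :=
      (Matrix.of fun j : Fin m => if h : (j : ℕ) < finrank F D then (b ⟨j, h⟩ : Fin n → F)
        else 0).transpose
    have hcol : ∀ j, M.col j = if h : (j : ℕ) < finrank F D then (b ⟨j, h⟩ : Fin n → F)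
        else 0 := fun j => rfl
    have hM : M ∈ colCode m D := by
      intro j
      rw [hcol]
      split_ifs with h
      · exact (b ⟨j, h⟩).2
      · exact D.zero_mem
    refine le_trans ?_ (rank_le_maxRank hM)
    have hspan : D = Submodule.span F (Set.range fun i => (b i : Fin n → F)) := by
      have := congrArg (Submodule.map D.subtype) b.span_eq
      rw [Submodule.map_span, ← Set.range_comp] at this
      rw [Submodule.map_top, Submodule.range_subtype] at this
      exact this.symm
    rw [Matrix.rank_eq_finrank_span_cols]
    refine Submodule.finrank_mono (hspan.le.trans (Submodule.span_mono ?_))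
    rintro _ ⟨i, rfl⟩
    exact ⟨Fin.castLE hd i, by simp [hcol]⟩

theorem isOptimalAnticode_colCode {F : Type*} [Field F] {n m : ℕ} (hnm : n ≤ m)
    (D : Submodule F (Fin n → F)) : IsOptimalAnticode (colCode m D) := by
  unfold IsOptimalAnticode
  rw [finrank_colCode, maxRank_colCode hnm, max_eq_right hnm]

/-! ### Equivalence with standard anticodes -/

/-- Every subspace is moved to a coordinate subspace by an invertible matrix. -/
theorem exists_isUnit_mulVec {F : Type*} [Field F] {n : ℕ} (D : Submodule F (Fin n → F)) :
    ∃ A : Matrix (Fin n) (Fin n) F, IsUnit A ∧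
      ∀ v, v ∈ D ↔ ∀ i : Fin n, finrank F D ≤ i → A.mulVec v i = 0 := by
  let E : Submodule F (Fin n → F) :=
    ⨅ i ∈ {i : Fin n | finrank F D ≤ i}, LinearMap.ker (LinearMap.proj i)
  have hmem : ∀ v, v ∈ E ↔ ∀ i : Fin n, finrank F D ≤ i → v i = 0 := fun v => by simp [E]
  have hd : finrank F D ≤ n := (Submodule.finrank_le D).trans (by simp)
  have hE : finrank F E = finrank F D := by
    let e := LinearMap.iInfKerProjEquiv F (fun _ : Fin n => F)
      (I := {i : Fin n | (i : ℕ) < finrank F D}) (J := {i : Fin n | finrank F D ≤ i})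
      (by rw [Set.disjoint_left]; intro i hi hi'; simp at hi hi'; omega)
      (fun i _ => by simpa using lt_or_ge _ _)
    rw [e.finrank_eq, finrank_pi, ← Set.toFinset_card]
    simp [Fin.card_filter_val_lt, hd]
  -- `E` is the coordinate subspace of the same dimension; an isomorphism from `D` to `E` extends to
  -- the whole space.
  obtain ⟨g, hg⟩ := Submodule.exists_linearEquiv_restrict_eq
    (LinearEquiv.ofFinrankEq D E hE.symm)
  refine ⟨LinearMap.toMatrix' g.toLinearMap, ?_, fun v => ?_⟩
  · rw [Matrix.isUnit_iff_isUnit_det, LinearMap.det_toMatrix']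
    exact g.isUnit_det'
  · have : ∀ v, (LinearMap.toMatrix' g.toLinearMap).mulVec v = g v := fun v =>
      LinearMap.toMatrix'_mulVec _ _
    rw [this, ← hmem]
    constructor
    · intro hv
      rw [← hg ⟨v, hv⟩]
      exact Subtype.property _
    · intro hv
      have h := hg ((LinearEquiv.ofFinrankEq D E hE.symm).symm ⟨g v, hv⟩)
      rw [LinearEquiv.apply_symm_apply] at h
      rw [g.injective h]
      exact Subtype.property _

theorem IsStandardOptimalAnticode.transposeCode {F : Type*} [Field F] {n m : ℕ}
    {S : Submodule F (Matrix (Fin n) (Fin m) F)} (hS : IsStandardOptimalAnticode S) :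
    IsStandardOptimalAnticode (transposeCode S) := by
  rcases hS with ⟨h, k, hk, hM⟩ | ⟨h, k, hk, hM⟩
  · refine Or.inr ⟨h, k, hk, fun M => ?_⟩
    rw [mem_transposeCode, hM]
    exact ⟨fun h i j => h j i, fun h i j => h j i⟩
  · refine Or.inl ⟨h, k, hk, fun M => ?_⟩
    rw [mem_transposeCode, hM]
    exact ⟨fun h i j => h j i, fun h i j => h j i⟩

/-- `C` is moved to a standard optimal anticode by left and right multiplication with
invertible matrices. -/
def IsStandardizable {F : Type*} [Field F] {n m : ℕ}
    (C : Submodule F (Matrix (Fin n) (Fin m) F)) : Prop :=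
  ∃ (A : Matrix (Fin n) (Fin n) F) (B : Matrix (Fin m) (Fin m) F)
    (S : Submodule F (Matrix (Fin n) (Fin m) F)), IsUnit A ∧ IsUnit B ∧
    IsStandardOptimalAnticode S ∧ ∀ M, M ∈ C ↔ A * M * B ∈ S

theorem IsStandardizable.transposeCode {F : Type*} [Field F] {n m : ℕ}
    {C : Submodule F (Matrix (Fin n) (Fin m) F)} (hC : IsStandardizable C) :
    IsStandardizable (transposeCode C) := by
  obtain ⟨A, B, S, hA, hB, hS, h⟩ := hC
  refine ⟨B.transpose, A.transpose, _, (Matrix.isUnit_transpose _).2 hB,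
    (Matrix.isUnit_transpose _).2 hA, hS.transposeCode, fun M => ?_⟩
  rw [mem_transposeCode, mem_transposeCode, h]
  simp [Matrix.transpose_mul, Matrix.mul_assoc]

theorem isStandardizable_colCode {F : Type*} [Field F] {n m : ℕ} (hnm : n ≤ m)
    (D : Submodule F (Fin n → F)) : IsStandardizable (colCode m D) := by
  obtain ⟨A, hA, h⟩ := exists_isUnit_mulVec D
  let E : Submodule F (Fin n → F) :=
    ⨅ i ∈ {i : Fin n | finrank F D ≤ i}, LinearMap.ker (LinearMap.proj i)
  have hmem : ∀ v, v ∈ E ↔ ∀ i : Fin n, finrank F D ≤ i → v i = 0 := fun v => by simp [E]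
  refine ⟨A, 1, colCode m E, hA, isUnit_one, Or.inl ⟨hnm, finrank F D,
    (Submodule.finrank_le D).trans (by simp), fun M => ?_⟩, fun M => ?_⟩
  · simp only [mem_colCode, hmem]
    exact ⟨fun h i j => h j i, fun h i j => h j i⟩
  · simp only [mem_colCode, hmem, h, Matrix.mul_one]
    rfl

theorem IsStandardizable.exists_isRankIsometry {F : Type*} [Field F] {n m : ℕ}
    {C : Submodule F (Matrix (Fin n) (Fin m) F)} (hC : IsStandardizable C) :
    ∃ S : Submodule F (Matrix (Fin n) (Fin m) F), IsStandardOptimalAnticode S ∧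
      ∃ φ : Matrix (Fin n) (Fin m) F →ₗ[F] Matrix (Fin n) (Fin m) F,
        IsRankIsometry φ ∧ C.map φ = S ∧
        ∃ (A : GL (Fin n) F) (B : GL (Fin m) F), ∀ M, φ M = A.val * M * B.val := by
  obtain ⟨_, _, S, ⟨A, rfl⟩, ⟨B, rfl⟩, hS, h⟩ := hC
  refine ⟨S, hS,
    { toFun := fun M => A.val * M * B.val
      map_add' := fun M N => by rw [Matrix.mul_add, Matrix.add_mul]
      map_smul' := fun c M => by rw [Matrix.mul_smul, Matrix.smul_mul]; rfl },
    fun M => ?_, ?_, A, B, fun _ => rfl⟩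
  · change (A.val * M * B.val).rank = M.rank
    rw [Matrix.rank_mul_eq_left_of_isUnit_det _ _
      ((Matrix.isUnit_iff_isUnit_det _).1 B.isUnit),
      Matrix.rank_mul_eq_right_of_isUnit_det _ _ ((Matrix.isUnit_iff_isUnit_det _).1 A.isUnit)]
  · ext N
    constructor
    · rintro ⟨M, hM, rfl⟩
      exact (h M).1 hM
    · intro hN
      have hinv : A.val * (A⁻¹.val * N * B⁻¹.val) * B.val = N := by
        rw [Matrix.mul_assoc A⁻¹.val, ← Matrix.mul_assoc A.val, A.mul_inv, Matrix.one_mul,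
          Matrix.mul_assoc, B.inv_mul, Matrix.mul_one]
      exact ⟨A⁻¹.val * N * B⁻¹.val, (h _).2 (by rwa [hinv]), hinv⟩

/-! ### Supports and the final statement -/

/-- A bijection of subspaces, not just a map, lets the quantifier over `V` be traded for one over
`D`, absorbing the reindexing of `Fin n` by `Fin (min m n)`. -/
theorem exists_matSupported_eq_colCode {F : Type*} [Field F] {n m : ℕ} (hnm : n ≤ m) :
    ∃ e : Submodule F (Fin n → F) ≃ Submodule F (Fin (min m n) → F),
      ∀ D, matSupported n m (e D) = colCode m D := by
  let e := LinearEquiv.funCongrLeft F F (finCongr (min_eq_right hnm))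
  refine ⟨(Submodule.orderIsoMapComap e).toEquiv, fun D => ?_⟩
  ext M
  have : M ∈ matSupported n m ((Submodule.orderIsoMapComap e).toEquiv D) ↔
      supp M ≤ D.map e.toLinearMap := ⟨fun h => h.2, fun h => ⟨trivial, h⟩⟩
  rw [this, supp, dif_pos hnm, Submodule.map_le_map_iff_of_injective e.injective, colsp,
    Submodule.span_le, Set.range_subset_iff]
  rfl

theorem exists_matSupported_eq_transposeCode {F : Type*} [Field F] {n m : ℕ} (hmn : m < n) :
    ∃ e : Submodule F (Fin m → F) ≃ Submodule F (Fin (min m n) → F),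
      ∀ D, matSupported n m (e D) = transposeCode (colCode n D) := by
  let e := LinearEquiv.funCongrLeft F F (finCongr (min_eq_left hmn.le))
  refine ⟨(Submodule.orderIsoMapComap e).toEquiv, fun D => ?_⟩
  ext M
  have : M ∈ matSupported n m ((Submodule.orderIsoMapComap e).toEquiv D) ↔
      supp M ≤ D.map e.toLinearMap := ⟨fun h => h.2, fun h => ⟨trivial, h⟩⟩
  rw [this, supp, dif_neg hmn.not_ge, Submodule.map_le_map_iff_of_injective e.injective, rowsp,
    Submodule.span_le, Set.range_subset_iff, mem_transposeCode]
  rfl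

theorem isOptimalAnticode_iff_of_lt {F : Type*} [Field F] {n m : ℕ} (hnm : n < m)
    {C : Submodule F (Matrix (Fin n) (Fin m) F)} :
    IsOptimalAnticode C ↔ ∃ D : Submodule F (Fin n → F), C = colCode m D := by
  constructor
  · intro h
    rcases exists_colCode_of_isOptimalAnticode hnm.le h with h | ⟨h, _⟩
    · exact h
    · exact absurd h hnm.ne
  · rintro ⟨D, rfl⟩
    exact isOptimalAnticode_colCode hnm.le D

theorem IsOptimalAnticode.isStandardizable {F : Type*} [Field F] {n m : ℕ} (hnm : n ≤ m)
    {C : Submodule F (Matrix (Fin n) (Fin m) F)} (hC : IsOptimalAnticode C) :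
    IsStandardizable C := by
  rcases exists_colCode_of_isOptimalAnticode hnm hC with ⟨D, rfl⟩ | ⟨h, D, rfl⟩
  · exact isStandardizable_colCode hnm D
  · exact (isStandardizable_colCode h.ge D).transposeCode

theorem mainTheorem2 {F : Type*} [Field F] [Finite F] :
    (∀ (n m : ℕ), m ≠ n → ∀ C : Submodule F (Matrix (Fin n) (Fin m) F),
      IsOptimalAnticode C ↔
        ∃ V : Submodule F (Fin (min m n) → F), C = matSupported n m V) ∧
    (∀ (n : ℕ) (C : Submodule F (Matrix (Fin n) (Fin n) F)),
      IsOptimalAnticode C ↔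
        ∃ V : Submodule F (Fin (min n n) → F),
          C = matSupported n n V ∨ C = transposeCode (matSupported n n V)) ∧
    (∀ (n m : ℕ) (C : Submodule F (Matrix (Fin n) (Fin m) F)), IsOptimalAnticode C →
      ∃ S : Submodule F (Matrix (Fin n) (Fin m) F), IsStandardOptimalAnticode S ∧
        ∃ φ : Matrix (Fin n) (Fin m) F →ₗ[F] Matrix (Fin n) (Fin m) F,
          IsRankIsometry φ ∧ C.map φ = S ∧
          ∃ (A : GL (Fin n) F) (B : GL (Fin m) F), ∀ M, φ M = A.val * M * B.val) := by
  refine ⟨fun n m hne C => ?_, fun n C => ?_, fun n m C hC => ?_⟩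
  · rcases hne.lt_or_gt with hmn | hnm
    · obtain ⟨e, he⟩ := exists_matSupported_eq_transposeCode (F := F) hmn
      rw [← e.exists_congr_right, ← isOptimalAnticode_transposeCode,
        isOptimalAnticode_iff_of_lt hmn]
      refine exists_congr fun D => ?_
      rw [he]
      constructor
      · intro h
        rw [← h, transposeCode_transposeCode]
      · rintro rfl
        rw [transposeCode_transposeCode]
    · obtain ⟨e, he⟩ := exists_matSupported_eq_colCode (F := F) hnm.le
      rw [← e.exists_congr_right, isOptimalAnticode_iff_of_lt hnm]
      exact exists_congr fun D => by rw [he]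
  · obtain ⟨e, he⟩ := exists_matSupported_eq_colCode (F := F) (le_refl n)
    rw [← e.exists_congr_right]
    simp only [he]
    constructor
    · intro h
      rcases exists_colCode_of_isOptimalAnticode le_rfl h with ⟨D, hD⟩ | ⟨_, D, hD⟩
      · exact ⟨D, Or.inl hD⟩
      · exact ⟨D, Or.inr hD⟩
    · rintro ⟨D, rfl | rfl⟩
      · exact isOptimalAnticode_colCode le_rfl D
      · exact isOptimalAnticode_transposeCode.2 (isOptimalAnticode_colCode le_rfl D)
  · refine IsStandardizable.exists_isRankIsometry ?_
    rcases le_total n m with h | h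
    · exact hC.isStandardizable h
    -- For `m ≤ n`, transpose, standardize and transpose back; the roles of the two invertible
    -- factors are exchanged.
    · have := ((isOptimalAnticode_transposeCode.2 hC).isStandardizable h).transposeCode
      rwa [transposeCode_transposeCode] at this
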